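/- **Definitions.** Let $d\ge 1$ and let $\Omega\subset\mathbb R^d$ be a closed regular cone: a closed convex set stable under multiplication by positive scalars, with $\Omega\cap(-\Omega)=\{0\}$ and non-empty interior. Put $G(\Omega)=\{g\in GL_d(\mathbb R)\mid g\Omega=\Omega\}$. A *conal manifold* $(N,\mathcal C)$ modelled on $\Omega$ is a smooth (Hausdorff) $d$-manifold $N$ with a reduction of the structure group of $TN$ to $G(\Omega)$; equivalently, with a cone $\mathcal C_x\subset T_xN$ for every $x\in N$ such that near every point there is a smooth local frame of $TN$ carrying $\Omega$ onto the cones $\mathcal C_x$. A curve $\gamma:[a,b]\to N$ with $a<b$ is *causal* if it is continuous, of class $C^\infty$ on $(a,b)$ away from finitely many points, and $\dot\gamma(t)\in\mathcal C_{\gamma(t)}$ for all but finitely many $t$. Write $x\preceq_s y$ if there is a causal curve from $x$ to $y$, and let the *closed causality* $\preceq$ be the closure of $\preceq_s$ in $N\times N$. The conal manifold is *causal* if $\preceq$ is a partial order, and *totally acausal* if $x\preceq y$ for all $x,y$. A diffeomorphism $\phi$ of $N$ is *causal* if $d\phi(\mathcal C_x)=\mathcal C_{\phi(x)}$ for all $x$.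 Let $(\widetilde M,\widetilde{\mathcal C})$ be a causal manifold and $T$ a causal diffeomorphism of $\widetilde M$ of infinite order such that the group $\Gamma\cong\mathbb Z$ generated by $T$ acts properly discontinuously on $\widetilde M$. Let $p:\widetilde M\to M=\Gamma\backslash\widetilde M$ be the covering projection onto the quotient manifold, equipped with the induced cone field $\mathcal C_{p(x)}=dp(\widetilde{\mathcal C}_x)$. Then $p$ is called a *causal covering* if $(M,\mathcal C)$ is totally acausal. An order automorphism $S$ of a poset $(X,\preceq)$ is *dominant* if for all $a,b\in X$ there is $n\in\mathbb N$ with $S^na\succ b$; the *completion* of $\preceq$ with respect to $S$ is the relation $a\preceq_S b:\Leftrightarrow\exists k\ge 0:\ S^ka\preceq b$. A partial order $\preceq$ on a topological space $X$ is *globally hyperbolic* if all intervals $\{z\mid x\preceq z\preceq y\}$ are compact and all sets $\{z\mid x\preceq z\}$ and $\{z\mid z\preceq x\}$ are closed. **Theorem.** Let $p:\widetilde M\to M$ be a causal covering, with deck group generated by $T$, and assume that $M$ is compact. Then the closed causality $\preceq$ on $\widetilde M$ is globally hyperbolic. Moreover, exactly one of $T$, $T^{-1}$ is dominant for $\preceq$,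 and, for this dominant generator $S$, the completion $\preceq_S$ is a partial order which is globally hyperbolic. -/

import Mathlib

open Set Topology
open scoped Manifold ContDiff

/-- Closed regular cones in a real vector space: closed convex subsets, stable under positive
scalars, pointed, with non-empty interior. -/
structure IsClosedRegularCone {V : Type*} [NormedAddCommGroup V] [NormedSpace ℝ V]
    (Ω : Set V) : Prop where
  isClosed : IsClosed Ω
  convex : Convex ℝ Ω
  smul_mem : ∀ c : ℝ, 0 < c → ∀ v ∈ Ω, c • v ∈ Ω
  pointed : Ω ∩ {v | -v ∈ Ω} = {0}
  regular : (interior Ω).Nonempty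

/-- A causal structure modelled on `Ω ⊆ ℝ^d` on a smooth `d`-manifold `M`, i.e. a reduction of the
structure group of `TM` from `GL_d(ℝ)` to `G(Ω) = {g | g Ω = Ω}`, given by its cone field: around
every point there is a smooth local frame of `TM` carrying `Ω` onto the cones. The principal
`G(Ω)`-bundle consists of all the frames `ℝ^d ≃ T_x M` which carry `Ω` onto `cone x`; any two
of them over the same point differ by an element of `G(Ω)`. -/
structure CausalStructure {d : ℕ} (Ω : Set (EuclideanSpace ℝ (Fin d))) (M : Type*)
    [TopologicalSpace M] [ChartedSpace (EuclideanSpace ℝ (Fin d)) M]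
    [IsManifold (𝓡 d) ∞ M] where
  /-- the cone in each tangent space -/
  cone : ∀ x : M, Set (TangentSpace (𝓡 d) x)
  exists_local_frame : ∀ x₀ : M, ∃ U : Set M, IsOpen U ∧ x₀ ∈ U ∧
    ∃ F : ∀ x : M, EuclideanSpace ℝ (Fin d) ≃ₗ[ℝ] TangentSpace (𝓡 d) x,
      (∀ v : EuclideanSpace ℝ (Fin d), ContMDiffOn (𝓡 d) (𝓡 d).tangent ∞
        (fun x => (⟨x, F x v⟩ : TangentBundle (𝓡 d) M)) U) ∧
      ∀ x ∈ U, F x '' Ω = cone x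

/-- A curve `γ : [a, b] → M` is piecewise smooth if it is continuous and of class `C^∞` on the
open interval away from finitely many points (the break points). -/
def IsPiecewiseSmooth {d : ℕ} {M : Type*} [TopologicalSpace M]
    [ChartedSpace (EuclideanSpace ℝ (Fin d)) M] (γ : ℝ → M) (a b : ℝ) : Prop :=
  ContinuousOn γ (Icc a b) ∧
    ∃ B : Set ℝ, B.Finite ∧ ContMDiffOn 𝓘(ℝ, ℝ) (𝓡 d) ∞ γ (Ioo a b \ B)

namespace CausalStructure

variable {d : ℕ} {Ω : Set (EuclideanSpace ℝ (Fin d))} {M : Type*}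
  [TopologicalSpace M] [ChartedSpace (EuclideanSpace ℝ (Fin d)) M] [IsManifold (𝓡 d) ∞ M]

/-- Causal curves: piecewise smooth curves whose velocity lies in the cone field at all but
finitely many times. -/
def IsCausalCurve (C : CausalStructure Ω M) (γ : ℝ → M) (a b : ℝ) : Prop :=
  IsPiecewiseSmooth (d := d) γ a b ∧
    ∃ B : Set ℝ, B.Finite ∧
      ∀ t ∈ Ioo a b \ B, mfderiv 𝓘(ℝ, ℝ) (𝓡 d) γ t (1 : ℝ) ∈ C.cone (γ t)

/-- The strict causality `≼ₛ`. -/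
def StrictCausality (C : CausalStructure Ω M) (x y : M) : Prop :=
  ∃ (a b : ℝ) (γ : ℝ → M), a < b ∧ C.IsCausalCurve γ a b ∧ γ a = x ∧ γ b = y

/-- The closed causality `≼`: the closure of `≼ₛ` in `M × M`. -/
def Causality (C : CausalStructure Ω M) (x y : M) : Prop :=
  (x, y) ∈ closure {q : M × M | C.StrictCausality q.1 q.2}

/-- Causal diffeomorphisms. -/
def IsCausalDiffeo (C : CausalStructure Ω M) (φ : M ≃ₘ^∞⟮𝓡 d, 𝓡 d⟯ M) : Prop :=
  ∀ x : M, mfderiv (𝓡 d) (𝓡 d) φ x '' C.cone x = C.cone (φ x)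

/-- `M` is causal if the closed causality is a partial order. -/
def IsCausal (C : CausalStructure Ω M) : Prop :=
  IsPartialOrder M C.Causality

/-- `M` is totally acausal if the closed causality is all of `M × M`. -/
def IsTotallyAcausal (C : CausalStructure Ω M) : Prop :=
  ∀ x y : M, C.Causality x y

end CausalStructure

/-- `p : N → M` is a causal covering with deck group generated by `T`: `N` is a causal manifold,
`T` is a causal diffeomorphism of `N` of infinite order, the powers of `T` act properly
discontinuously, `M` is (via `p`) the quotient of `N` by this action, with the smooth structure and
the cone field that descend from `N`, and `M` is totally acausal. -/
structure IsCausalCovering {d : ℕ} {Ω : Set (EuclideanSpace ℝ (Fin d))} {N M : Type*}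
    [TopologicalSpace N] [ChartedSpace (EuclideanSpace ℝ (Fin d)) N] [IsManifold (𝓡 d) ∞ N]
    [TopologicalSpace M] [ChartedSpace (EuclideanSpace ℝ (Fin d)) M] [IsManifold (𝓡 d) ∞ M]
    (CN : CausalStructure Ω N) (CM : CausalStructure Ω M)
    (T : N ≃ₘ^∞⟮𝓡 d, 𝓡 d⟯ N) (p : N → M) : Prop where
  isCausal : CN.IsCausal
  isCausalDiffeo : CN.IsCausalDiffeo T
  infinite_order : ∀ n : ℤ, n ≠ 0 → (T.toEquiv : Equiv.Perm N) ^ n ≠ 1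
  properlyDiscontinuous : ∀ K L : Set N, IsCompact K → IsCompact L →
    {n : ℤ | (((T.toEquiv : Equiv.Perm N) ^ n) '' K ∩ L).Nonempty}.Finite
  isCoveringMap : IsCoveringMap p
  surjective : Function.Surjective p
  fiber_eq_orbit : ∀ x y : N, p x = p y ↔ ∃ n : ℤ, ((T.toEquiv : Equiv.Perm N) ^ n) x = y
  isLocalDiffeomorph : IsLocalDiffeomorph (𝓡 d) (𝓡 d) ∞ p
  map_cone : ∀ x : N, mfderiv (𝓡 d) (𝓡 d) p x '' CN.cone x = CM.cone (p x)
  isTotallyAcausal : CM.IsTotallyAcausal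

/-- A permutation `S` is a dominant automorphism of the partially ordered set `(X, r)` if it is an
order automorphism and for all `a b` some `S ^ n a` with `n ∈ ℕ` is strictly above `b`. -/
def IsDominant {X : Type*} (r : X → X → Prop) (S : Equiv.Perm X) : Prop :=
  (∀ a b, r (S a) (S b) ↔ r a b) ∧ ∀ a b, ∃ n : ℕ, r b ((S ^ n) a) ∧ b ≠ (S ^ n) a

/-- The completion `≼_S` of a relation: `a ≼_S b` iff `S ^ k a ≼ b` for some `k ≥ 0`. -/
def Completion {X : Type*} (r : X → X → Prop) (S : Equiv.Perm X) (a b : X) : Prop :=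
  ∃ k : ℕ, r ((S ^ k) a) b

/-- A partial order on a topological space is globally hyperbolic if the finite order intervals are
compact and the infinite ones are closed. -/
structure IsGloballyHyperbolic {X : Type*} [TopologicalSpace X] (r : X → X → Prop) : Prop where
  isPartialOrder : IsPartialOrder X r
  isCompact_Icc : ∀ x y, IsCompact {z | r x z ∧ r z y}
  isClosed_Ici : ∀ x, IsClosed {z | r x z}
  isClosed_Iic : ∀ x, IsClosed {z | r z x}

/-! Total acausality of `M` says that causal curves join any two points up to an arbitrarily small
perturbation. Points reachable from a given point contain an open set, and dually, so the
perturbation can be absorbed; lifting the curves then shows that every point of `N` lies below some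
deck translate of any other (`exists_causality_zpow`).

Take `y` strictly above `x`, and `n` with `y ≼ T ^ n x`. Then `x ≺ T ^ n x`, and the sign of `n`
selects the generator `S`. By antisymmetry, `S ^ i x ≼ S ^ j x` now forces `i ≤ j`
(`le_of_rel_zpow`), so the orbit of `x` serves as a ruler: locally, points lie between two fixed
rungs. This makes the union over `k` defining the completion locally finite, hence closed.
Compactness of `M` gives a compact `K` whose translates cover `N`; an interval of the completion
meets only finitely many of them, so it is compact. Intervals of `≼` are closed subsets of these. -/

/-! ### Orders with a cocompact, dominating automorphism -/

section Order

variable {X : Type*} {r : X → X → Prop} {S : Equiv.Perm X}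

lemma rel_zpow_apply_iff (hS : ∀ a b, r (S a) (S b) ↔ r a b) (n : ℤ) (a b : X) :
    r ((S ^ n) a) ((S ^ n) b) ↔ r a b := by
  induction n using Int.induction_on generalizing a b with
  | zero => simp
  | succ n ih => rw [zpow_add_one, Equiv.Perm.mul_apply, Equiv.Perm.mul_apply, ih, hS]
  | pred n ih =>
    rw [zpow_sub_one, Equiv.Perm.mul_apply, Equiv.Perm.mul_apply, ih, ← hS]
    simp

lemma rel_zpow_shift (hS : ∀ a b, r (S a) (S b) ↔ r a b) (n i j : ℤ) {a b : X}
    (h : r ((S ^ i) a) ((S ^ j) b)) : r ((S ^ (n + i)) a) ((S ^ (n + j)) b) := by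
  rw [zpow_add, zpow_add, Equiv.Perm.mul_apply, Equiv.Perm.mul_apply]
  exact (rel_zpow_apply_iff hS n _ _).2 h

lemma rel_zpow_mul [hr : IsPartialOrder X r] (hS : ∀ a b, r (S a) (S b) ↔ r a b) {x : X} {c : ℤ}
    (h : r x ((S ^ c) x)) (k : ℕ) : r x ((S ^ (k * c)) x) := by
  induction k with
  | zero => simpa using refl_of r x
  | succ k ih =>
    have h' := rel_zpow_shift hS (k * c) 0 c (a := x) (b := x) (by simpa using h)
    rw [add_zero] at h'
    convert trans_of r ih h' using 3
    push_cast; ring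

/-- If `i > j`, iterating the relation `n` times gives `S ^ (n * (i - j)) x ≼ x`. Iterating `h`
gives `S ^ n x ≼ S ^ (n * (i - j)) x`. Hence `S ^ n x ≼ x ≼ S ^ n x`, against antisymmetry. -/
lemma le_of_rel_zpow [hr : IsPartialOrder X r] (hS : ∀ a b, r (S a) (S b) ↔ r a b) {x : X} {n : ℕ}
    (h : r x ((S ^ (n : ℤ)) x)) (hne : (S ^ (n : ℤ)) x ≠ x) {i j : ℤ}
    (hij : r ((S ^ i) x) ((S ^ j) x)) : i ≤ j := by
  by_contra! hlt
  obtain ⟨e, he⟩ : ∃ e : ℕ, i - j = e + 1 := ⟨(i - j - 1).toNat, by omega⟩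
  have h1 : r x ((S ^ (j - i)) x) := by
    have := rel_zpow_shift hS (-i) _ _ hij
    simpa [neg_add_eq_sub] using this
  have h2 := rel_zpow_mul hS h1 n
  have h3 := rel_zpow_shift hS (n * (i - j)) 0 (n * (j - i)) (a := x) (b := x) (by simpa using h2)
  have h4 := rel_zpow_mul hS h e
  have h5 := rel_zpow_shift hS n 0 (e * n) (a := x) (b := x) (by simpa using h4)
  have e1 : (n : ℤ) * (i - j) + n * (j - i) = 0 := by ring
  have e2 : (n : ℤ) * (i - j) + 0 = n + e * n := by rw [he]; ring
  rw [e1, e2] at h3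
  rw [add_zero] at h5
  exact hne (antisymm_of r (by simpa using trans_of r h5 h3) h)

/-- The data on a partially ordered space `X` and an automorphism `S` which force the global
hyperbolicity of the order and of its completion. -/
structure IsCocompactDominated [TopologicalSpace X] (r : X → X → Prop) (S : Equiv.Perm X) :
    Prop where
  isPartialOrder : IsPartialOrder X r
  isClosed : IsClosed {q : X × X | r q.1 q.2}
  map_rel : ∀ a b, r (S a) (S b) ↔ r a b
  continuous_zpow : ∀ n : ℤ, Continuous (S ^ n)
  eventually_le : ∀ x, ∃ y, ∀ᶠ z in 𝓝 x, r z y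
  eventually_ge : ∀ x, ∃ y, ∀ᶠ z in 𝓝 x, r y z
  exists_rel_zpow : ∀ x y, ∃ n : ℤ, r x ((S ^ n) y)
  finite_zpow_eq : ∀ a b, {n : ℤ | (S ^ n) a = b}.Finite
  exists_isCompact : ∃ K : Set X, IsCompact K ∧ ∀ z, ∃ n : ℤ, ∃ k ∈ K, z = (S ^ n) k
  exists_rel_iterate : ∃ x, ∃ n : ℕ, r x ((S ^ (n : ℤ)) x) ∧ (S ^ (n : ℤ)) x ≠ x

namespace IsCocompactDominated

variable [TopologicalSpace X]

lemma isDominant (h : IsCocompactDominated r S) : IsDominant r S := by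
  have := h.isPartialOrder
  refine ⟨h.map_rel, fun a b => ?_⟩
  obtain ⟨x, n, hx, hne⟩ := h.exists_rel_iterate
  have hn : n ≠ 0 := by rintro rfl; simp at hne
  obtain ⟨m, hm⟩ := h.exists_rel_zpow b x
  obtain ⟨l, hl⟩ := h.exists_rel_zpow x a
  obtain ⟨B, hB⟩ := (h.finite_zpow_eq a b).bddAbove
  have key : ∀ k : ℕ, r b ((S ^ (m + k * n + l)) a) := fun k => by
    have h1 := rel_zpow_shift h.map_rel m 0 (k * n) (a := x) (b := x)
      (by simpa using rel_zpow_mul h.map_rel hx k)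
    have h2 := rel_zpow_shift h.map_rel (m + k * n) 0 l (a := x) (b := a) (by simpa using hl)
    rw [add_zero] at h1 h2
    exact trans_of r hm (trans_of r h1 h2)
  -- Since `n ≥ 1`, this makes `m + k * n + l` at least `|B| + 1`: the exponent is a natural number,
  -- and no power that large takes `a` to `b`, so the relation is strict.
  obtain ⟨k, hk⟩ : ∃ k : ℕ, k = m.natAbs + l.natAbs + B.natAbs + 1 := ⟨_, rfl⟩
  have hkn : (k : ℤ) ≤ k * n := by
    exact_mod_cast Nat.le_mul_of_pos_right k (Nat.pos_of_ne_zero hn)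
  obtain ⟨j, hj⟩ : ∃ j : ℕ, m + k * n + l = j := ⟨(m + k * n + l).toNat, by omega⟩
  have hkj := key k
  rw [hj] at hkj
  refine ⟨j, by simpa using hkj, fun hb => ?_⟩
  have : (j : ℤ) ≤ B := hB (by simpa using hb.symm)
  omega

lemma not_isDominant_inv (h : IsCocompactDominated r S) : ¬ IsDominant r S⁻¹ := by
  have := h.isPartialOrder
  intro hd
  obtain ⟨x, n, hx, hne⟩ := h.exists_rel_iterate
  obtain ⟨m, hm, hxm⟩ := hd.2 x x
  have := le_of_rel_zpow h.map_rel hx hne (i := 0) (j := -m) (by simpa using hm)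
  obtain rfl : m = 0 := by omega
  simp at hxm

lemma isPartialOrder_completion (h : IsCocompactDominated r S) :
    IsPartialOrder X (Completion r S) := by
  have := h.isPartialOrder
  have shift : ∀ {a b : X} {k : ℕ} (l : ℕ), r ((S ^ k) a) b →
      r ((S ^ ((l + k : ℕ) : ℤ)) a) ((S ^ (l : ℤ)) b) := fun {a b k} l hab => by
    have := rel_zpow_shift h.map_rel l k 0 (a := a) (b := b) (by simpa using hab)
    simpa using this
  have hrefl : ∀ a, Completion r S a a := fun a => ⟨0, by simpa using refl_of r a⟩
  have htrans : ∀ a b c, Completion r S a b → Completion r S b c → Completion r S a c := by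
    rintro a b c ⟨k, hk⟩ ⟨l, hl⟩
    have hac := trans_of r (shift l hk) (by simpa using hl)
    rw [zpow_natCast] at hac
    exact ⟨l + k, hac⟩
  have hantisymm : ∀ a b, Completion r S a b → Completion r S b a → a = b := by
    rintro a b ⟨k, hk⟩ ⟨l, hl⟩
    -- Dominance makes `a` itself a base point of a ruler, and `S ^ (l + k) a ≼ a` then forces `l +
    -- k ≤ 0`.
    have hd := h.isDominant.2 a a
    obtain ⟨n, hn, hne⟩ := hd
    have hlk : r ((S ^ ((l + k : ℕ) : ℤ)) a) ((S ^ (0 : ℤ)) a) := by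
      simpa using trans_of r (shift l hk) (by simpa using hl)
    have := le_of_rel_zpow h.map_rel (by simpa using hn) (by simpa using hne.symm) hlk
    obtain ⟨rfl, rfl⟩ : k = 0 ∧ l = 0 := by omega
    exact antisymm_of r (by simpa using hk) (by simpa using hl)
  exact { refl := hrefl, trans := htrans, antisymm := hantisymm }

lemma eventually_le_zpow (h : IsCocompactDominated r S) (x z₀ : X) :
    ∃ m : ℤ, ∀ᶠ z in 𝓝 z₀, r z ((S ^ m) x) := by
  have := h.isPartialOrder
  obtain ⟨y, hy⟩ := h.eventually_le z₀
  obtain ⟨m, hm⟩ := h.exists_rel_zpow y x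
  exact ⟨m, hy.mono fun z hz => trans_of r hz hm⟩

lemma eventually_zpow_le (h : IsCocompactDominated r S) (x z₀ : X) :
    ∃ m : ℤ, ∀ᶠ z in 𝓝 z₀, r ((S ^ m) x) z := by
  have := h.isPartialOrder
  obtain ⟨y, hy⟩ := h.eventually_ge z₀
  obtain ⟨m, hm⟩ := h.exists_rel_zpow x y
  refine ⟨-m, hy.mono fun z hz => trans_of r ?_ hz⟩
  simpa using rel_zpow_shift h.map_rel (-m) 0 m (a := x) (b := y) (by simpa using hm)

/-- The exponents are only bounded, not fixed: `x ≼ S x` may fail, so a lower rung need not lie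
below a higher one and local bounds cannot be merged into a single rung. -/
lemma exists_forall_mem_compact (h : IsCocompactDominated r S) (x : X) {K : Set X}
    (hK : IsCompact K) :
    ∃ m : ℤ, ∀ k ∈ K, (∃ j ≤ m, r k ((S ^ j) x)) ∧ ∃ j ≥ -m, r ((S ^ j) x) k := by
  refine hK.induction_on ⟨0, by simp⟩ ?_ ?_ ?_
  · rintro s t hst ⟨m, hm⟩
    exact ⟨m, fun k hk => hm k (hst hk)⟩
  · rintro s t ⟨m, hm⟩ ⟨m', hm'⟩
    refine ⟨max m m', ?_⟩
    rintro k (hk | hk)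
    · obtain ⟨⟨j, hj, hr⟩, j', hj', hr'⟩ := hm k hk
      exact ⟨⟨j, by omega, hr⟩, j', by omega, hr'⟩
    · obtain ⟨⟨j, hj, hr⟩, j', hj', hr'⟩ := hm' k hk
      exact ⟨⟨j, by omega, hr⟩, j', by omega, hr'⟩
  · intro z _
    obtain ⟨m, hm⟩ := h.eventually_le_zpow x z
    obtain ⟨m', hm'⟩ := h.eventually_zpow_le x z
    exact ⟨_, mem_nhdsWithin_of_mem_nhds (hm.and hm'), max m (-m'),
      fun k hk => ⟨⟨m, by omega, hk.1⟩, m', by omega, hk.2⟩⟩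

/-- Near `z₀` all points lie below one rung `S ^ m x`, while `S ^ k a` lies above `S ^ (k - q) x`.
So `S ^ k a ≼ z` forces `k ≤ m + q`, and the union over `k` is locally finite. -/
lemma isClosed_completion_Ici (h : IsCocompactDominated r S) (a : X) :
    IsClosed {z | Completion r S a z} := by
  have := h.isPartialOrder
  obtain ⟨x, n, hx, hne⟩ := h.exists_rel_iterate
  have hU : {z | Completion r S a z} = ⋃ k : ℕ, {z | r ((S ^ k) a) z} := by
    ext z; simp [Completion]
  rw [hU]
  refine LocallyFinite.isClosed_iUnion (fun z₀ => ?_) fun k =>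
    h.isClosed.preimage (Continuous.prodMk_right ((S ^ k) a))
  obtain ⟨m, hm⟩ := h.eventually_le_zpow x z₀
  obtain ⟨q, hq⟩ := h.exists_rel_zpow x a
  refine ⟨_, hm, (finite_le_nat (m + q).toNat).subset ?_⟩
  rintro k ⟨z, hz, hz'⟩
  have h1 := rel_zpow_shift h.map_rel (k - q) 0 q (a := x) (b := a) (by simpa using hq)
  rw [add_zero, sub_add_cancel] at h1
  have := le_of_rel_zpow h.map_rel hx hne
    (trans_of r h1 (trans_of r (by simpa using hz) hz'))
  simp only [mem_ofPred_eq]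
  omega

lemma isClosed_completion_Iic (h : IsCocompactDominated r S) (b : X) :
    IsClosed {z | Completion r S z b} := by
  have := h.isPartialOrder
  obtain ⟨x, n, hx, hne⟩ := h.exists_rel_iterate
  have hU : {z | Completion r S z b} = ⋃ k : ℕ, {z | r ((S ^ (k : ℤ)) z) b} := by
    ext z; simp [Completion]
  rw [hU]
  refine LocallyFinite.isClosed_iUnion (fun z₀ => ?_) fun k =>
    h.isClosed.preimage ((h.continuous_zpow k).prodMk continuous_const)
  obtain ⟨m, hm⟩ := h.eventually_zpow_le x z₀
  obtain ⟨q, hq⟩ := h.exists_rel_zpow b x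
  refine ⟨_, hm, (finite_le_nat (q - m).toNat).subset ?_⟩
  rintro k ⟨z, hz, hz'⟩
  have h1 := rel_zpow_shift h.map_rel k m 0 (a := x) (b := z) (by simpa using hz')
  rw [add_zero] at h1
  have := le_of_rel_zpow h.map_rel hx hne (trans_of r h1 (trans_of r hz hq))
  simp only [mem_ofPred_eq]
  omega

lemma isGloballyHyperbolic_completion (h : IsCocompactDominated r S) :
    IsGloballyHyperbolic (Completion r S) := by
  have := h.isPartialOrder
  refine ⟨h.isPartialOrder_completion, fun a b => ?_, h.isClosed_completion_Ici,
    h.isClosed_completion_Iic⟩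
  obtain ⟨x, n, hx, hne⟩ := h.exists_rel_iterate
  obtain ⟨K, hK, hKX⟩ := h.exists_isCompact
  obtain ⟨m, hm⟩ := h.exists_forall_mem_compact x hK
  obtain ⟨p, hp⟩ := h.exists_rel_zpow x a
  obtain ⟨q, hq⟩ := h.exists_rel_zpow b x
  -- If `z = S ^ i κ` lies in the interval, comparing it with the ruler gives `k - p ≤ i + m` and `l
  -- + i - m ≤ q`; as `k, l ≥ 0`, `i` lies in this range.
  have hcpt : IsCompact (⋃ i ∈ Icc (-(p + m)) (q + m), (S ^ i) '' K) :=
    (finite_Icc _ _).isCompact_biUnion fun i _ => hK.image (h.continuous_zpow i)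
  refine hcpt.of_isClosed_subset
    ((h.isClosed_completion_Ici a).inter (h.isClosed_completion_Iic b)) ?_
  rintro z ⟨⟨k, hk⟩, l, hl⟩
  obtain ⟨i, κ, hκ, rfl⟩ := hKX z
  obtain ⟨⟨j, hj, hrj⟩, j', hj', hrj'⟩ := hm κ hκ
  simp only [mem_iUnion]
  refine ⟨i, ⟨?_, ?_⟩, κ, hκ, rfl⟩
  · have h1 := rel_zpow_shift h.map_rel (k - p) 0 p (a := x) (b := a) (by simpa using hp)
    have h2 := rel_zpow_shift h.map_rel i 0 j (a := κ) (b := x) (by simpa using hrj)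
    rw [add_zero, sub_add_cancel] at h1
    rw [add_zero] at h2
    have := le_of_rel_zpow h.map_rel hx hne
      (trans_of r h1 (trans_of r (by simpa using hk) h2))
    omega
  · have h2 := rel_zpow_shift h.map_rel (l + i) j' 0 (a := x) (b := κ) (by simpa using hrj')
    rw [add_zero, zpow_add _ (l : ℤ) i, Equiv.Perm.mul_apply] at h2
    have := le_of_rel_zpow h.map_rel hx hne
      (trans_of r h2 (trans_of r (by simpa using hl) hq))
    omega

lemma isGloballyHyperbolic (h : IsCocompactDominated r S) : IsGloballyHyperbolic r := by
  have hIci : ∀ x, IsClosed {z | r x z} := fun x =>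
    h.isClosed.preimage (Continuous.prodMk_right x)
  have hIic : ∀ x, IsClosed {z | r z x} := fun x =>
    h.isClosed.preimage (Continuous.prodMk_left x)
  refine ⟨h.isPartialOrder, fun x y => ?_, hIci, hIic⟩
  refine (h.isGloballyHyperbolic_completion.isCompact_Icc x y).of_isClosed_subset
    ((hIci x).inter (hIic y)) ?_
  rintro z ⟨hxz, hzy⟩
  exact ⟨⟨0, by simpa using hxz⟩, 0, by simpa using hzy⟩

end IsCocompactDominated

end Order

/-! ### Lifting causal curves and invariance under causal diffeomorphisms -/

section Lift

variable {d : ℕ} {Ω : Set (EuclideanSpace ℝ (Fin d))} {N M : Type*}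
  [TopologicalSpace N] [ChartedSpace (EuclideanSpace ℝ (Fin d)) N] [IsManifold (𝓡 d) ∞ N]
  [TopologicalSpace M] [ChartedSpace (EuclideanSpace ℝ (Fin d)) M] [IsManifold (𝓡 d) ∞ M]

omit [IsManifold (𝓡 d) ∞ N] [IsManifold (𝓡 d) ∞ M] in
lemma IsLocalDiffeomorphAt.contMDiffAt_of_comp {φ : N → M} {γ : ℝ → N} {t : ℝ}
    (hφ : IsLocalDiffeomorphAt (𝓡 d) (𝓡 d) ∞ φ (γ t)) (hγ : ContinuousAt γ t)
    (h : ContMDiffAt 𝓘(ℝ, ℝ) (𝓡 d) ∞ (φ ∘ γ) t) : ContMDiffAt 𝓘(ℝ, ℝ) (𝓡 d) ∞ γ t := by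
  have h1 : ContMDiffAt 𝓘(ℝ, ℝ) (𝓡 d) ∞ (hφ.localInverse ∘ (φ ∘ γ)) t :=
    ContMDiffAt.comp t hφ.localInverse_contMDiffAt h
  refine h1.congr_of_eventuallyEq ?_
  filter_upwards [hγ.eventually hφ.localInverse_eventuallyEq_left] with s hs
  exact hs.symm

namespace CausalStructure

variable {CN : CausalStructure Ω N} {CM : CausalStructure Ω M}

/-- A continuous curve is causal if and only if its image under a causal local diffeomorphism
is. -/
lemma isCausalCurve_comp_iff {φ : N → M} (hφ : IsLocalDiffeomorph (𝓡 d) (𝓡 d) ∞ φ)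
    (hcone : ∀ x, mfderiv (𝓡 d) (𝓡 d) φ x '' CN.cone x = CM.cone (φ x)) {γ : ℝ → N} {a b : ℝ}
    (hγ : ContinuousOn γ (Icc a b)) :
    CM.IsCausalCurve (φ ∘ γ) a b ↔ CN.IsCausalCurve γ a b := by
  have hvel : ∀ t, MDifferentiableAt 𝓘(ℝ, ℝ) (𝓡 d) γ t →
      (mfderiv 𝓘(ℝ, ℝ) (𝓡 d) (φ ∘ γ) t (1 : ℝ) ∈ CM.cone (φ (γ t)) ↔
        mfderiv 𝓘(ℝ, ℝ) (𝓡 d) γ t (1 : ℝ) ∈ CN.cone (γ t)) := by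
    intro t ht
    have hinj : Function.Injective (mfderiv (𝓡 d) (𝓡 d) φ (γ t)) := by
      rw [← hφ.mfderivToContinuousLinearEquiv_coe (by simp) (γ t)]
      exact ContinuousLinearEquiv.injective _
    rw [mfderiv_comp t (hφ.mdifferentiable (by simp) (γ t)) ht, ← hcone]
    exact hinj.mem_set_image
  have hopen : ∀ {B : Set ℝ}, B.Finite → IsOpen (Ioo a b \ B) := fun hB =>
    isOpen_Ioo.sdiff hB.isClosed
  constructor
  · rintro ⟨⟨-, B, hB, hs⟩, B', hB', hc⟩
    have hs' : ContMDiffOn 𝓘(ℝ, ℝ) (𝓡 d) ∞ γ (Ioo a b \ B) := fun t ht =>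
      ((hφ (γ t)).contMDiffAt_of_comp (hγ.continuousAt (Icc_mem_nhds ht.1.1 ht.1.2))
        (hs.contMDiffAt ((hopen hB).mem_nhds ht))).contMDiffWithinAt
    refine ⟨⟨hγ, B, hB, hs'⟩, B ∪ B', hB.union hB', fun t ht => ?_⟩
    rw [← sdiff_sdiff] at ht
    exact (hvel t ((hs'.contMDiffAt ((hopen hB).mem_nhds ht.1)).mdifferentiableAt (by simp))).1
      (hc t ⟨ht.1.1, ht.2⟩)
  · rintro ⟨⟨-, B, hB, hs⟩, B', hB', hc⟩
    refine ⟨⟨hφ.contMDiff.continuous.comp_continuousOn hγ, B, hB, hφ.contMDiff.comp_contMDiffOn hs⟩,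
      B ∪ B', hB.union hB', fun t ht => ?_⟩
    rw [← sdiff_sdiff] at ht
    exact (hvel t ((hs.contMDiffAt ((hopen hB).mem_nhds ht.1)).mdifferentiableAt (by simp))).2
      (hc t ⟨ht.1.1, ht.2⟩)

lemma StrictCausality.lift {p : N → M} (hcov : IsCoveringMap p)
    (hp : IsLocalDiffeomorph (𝓡 d) (𝓡 d) ∞ p)
    (hcone : ∀ x, mfderiv (𝓡 d) (𝓡 d) p x '' CN.cone x = CM.cone (p x)) {x : N} {y : M}
    (h : CM.StrictCausality (p x) y) : ∃ z, p z = y ∧ CN.StrictCausality x z := by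
  obtain ⟨a, b, γ, hab, hγ, hγa, hγb⟩ := h
  -- `γ` is controlled only on `[a, b]`; a constant extension beyond the endpoints gives a
  -- continuous map on the simply connected space `ℝ`, to which unique lifting applies.
  let f : C(ℝ, M) := ⟨IccExtend hab.le ((Icc a b).domRestrict γ),
    (continuousOn_iff_continuous_domRestrict.1 hγ.1.1).Icc_extend'⟩
  have hf : ∀ t ∈ Icc a b, f t = γ t := fun t ht =>
    IccExtend_of_mem hab.le ((Icc a b).domRestrict γ) ht
  have ha := left_mem_Icc.2 hab.le
  have hb := right_mem_Icc.2 hab.le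
  obtain ⟨F, ⟨hFa, hF⟩, -⟩ := hcov.existsUnique_continuousMap_lifts f a x (by rw [hf a ha, hγa])
  have hFt : ∀ t, p (F t) = f t := fun t => congrFun hF t
  refine ⟨F b, by rw [hFt, hf b hb, hγb], a, b, F, hab, ?_, hFa, rfl⟩
  rw [← isCausalCurve_comp_iff hp hcone F.continuous.continuousOn, hF]
  have hev : ∀ t ∈ Ioo a b, f =ᶠ[𝓝 t] γ := fun t ht => by
    filter_upwards [Ioo_mem_nhds ht.1 ht.2] with s hs using hf s (Ioo_subset_Icc_self hs)
  obtain ⟨⟨hc, B, hB, hs⟩, B', hB', hcc⟩ := hγ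
  refine ⟨⟨f.continuous.continuousOn, B, hB,
    hs.congr fun t ht => hf t (Ioo_subset_Icc_self ht.1)⟩, B', hB', fun t ht => ?_⟩
  have := hcc t ht
  rw [(hev t ht.1).mfderiv_eq, hf t (Ioo_subset_Icc_self ht.1)]
  exact this

namespace IsCausalDiffeo

variable {φ : N ≃ₘ^∞⟮𝓡 d, 𝓡 d⟯ N}

lemma strictCausality_iff (hφ : CN.IsCausalDiffeo φ) (x y : N) :
    CN.StrictCausality (φ x) (φ y) ↔ CN.StrictCausality x y := by
  constructor
  · rintro ⟨a, b, γ, hab, hγ, hγa, hγb⟩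
    refine ⟨a, b, φ.symm ∘ γ, hab, ?_, by simp [hγa], by simp [hγb]⟩
    rw [← isCausalCurve_comp_iff φ.isLocalDiffeomorph hφ
      (φ.symm.continuous.comp_continuousOn hγ.1.1)]
    convert hγ using 1
    ext t
    simp
  · rintro ⟨a, b, γ, hab, hγ, hγa, hγb⟩
    exact ⟨a, b, φ ∘ γ, hab, (isCausalCurve_comp_iff φ.isLocalDiffeomorph hφ hγ.1.1).2 hγ,
      by simp [hγa], by simp [hγb]⟩

lemma causality_iff (hφ : CN.IsCausalDiffeo φ) (x y : N) :
    CN.Causality (φ x) (φ y) ↔ CN.Causality x y := by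
  have hpre : (φ.toHomeomorph.prodCongr φ.toHomeomorph) ⁻¹'
      {q : N × N | CN.StrictCausality q.1 q.2} = {q | CN.StrictCausality q.1 q.2} := by
    ext q
    exact hφ.strictCausality_iff q.1 q.2
  have := (φ.toHomeomorph.prodCongr φ.toHomeomorph).preimage_closure
    {q : N × N | CN.StrictCausality q.1 q.2}
  rw [hpre] at this
  exact Set.ext_iff.1 this (x, y)

end IsCausalDiffeo

end CausalStructure

end Lift

/-! ### Local structure of the causality near a point -/

section Cone

variable {d : ℕ} {Ω : Set (EuclideanSpace ℝ (Fin d))}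

/-- If `0` were interior, `Ω ∩ -Ω = {0}` would be a neighbourhood of `0`, which is impossible in
positive dimension. -/
lemma IsClosedRegularCone.ne_zero_of_mem_interior (hd : 0 < d) (hΩ : IsClosedRegularCone Ω)
    {v : EuclideanSpace ℝ (Fin d)} (hv : v ∈ interior Ω) : v ≠ 0 := by
  rintro rfl
  have : Nonempty (Fin d) := ⟨⟨0, hd⟩⟩
  have h1 : Ω ∈ 𝓝 (0 : EuclideanSpace ℝ (Fin d)) := mem_interior_iff_mem_nhds.1 hv
  have h2 : {v | -v ∈ Ω} ∈ 𝓝 (0 : EuclideanSpace ℝ (Fin d)) :=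
    continuous_neg.continuousAt.preimage_mem_nhds (by simpa using h1)
  have h3 := Filter.inter_mem h1 h2
  rw [hΩ.pointed] at h3
  exact Filter.NeBot.ne (Module.punctured_nhds_neBot ℝ (EuclideanSpace ℝ (Fin d)) 0)
    ((isOpen_singleton_iff_punctured_nhds _).1 (isOpen_singleton_iff_nhds_eq_pure _ |>.2
      ((Filter.le_pure_iff.2 h3).antisymm (pure_le_nhds 0))))

end Cone

namespace CausalStructure

variable {d : ℕ} {Ω : Set (EuclideanSpace ℝ (Fin d))} {M : Type*}
  [TopologicalSpace M] [ChartedSpace (EuclideanSpace ℝ (Fin d)) M] [IsManifold (𝓡 d) ∞ M]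

/-- In the trivialization at `x₀` the local frame becomes a family `A x` of linear maps, continuous
and invertible at `x₀`. For `v` interior to `Ω` and `w = A x₀ v`, the map `(x, w') ↦ (A x)⁻¹ w'` is
continuous at `(x₀, w)` with value `v`, so it takes values in `Ω` nearby. -/
lemma exists_eventually_mem_cone (hd : 0 < d) (hΩ : IsClosedRegularCone Ω)
    (C : CausalStructure Ω M) (x₀ : M) :
    ∃ w : EuclideanSpace ℝ (Fin d), w ≠ 0 ∧ ∀ᶠ q : M × EuclideanSpace ℝ (Fin d) in 𝓝 (x₀, w),
      ∀ u : TangentSpace (𝓡 d) q.1,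
        mfderiv (𝓡 d) 𝓘(ℝ, EuclideanSpace ℝ (Fin d)) (extChartAt (𝓡 d) x₀) q.1 u = q.2 →
          u ∈ C.cone q.1 := by
  have : IsManifold (𝓡 d) 1 M := IsManifold.of_le (n := ∞) (by simp)
  obtain ⟨U, hU, hxU, F, hF, hcone⟩ := C.exists_local_frame x₀
  obtain ⟨v, hv⟩ := hΩ.regular
  set e := trivializationAt (EuclideanSpace ℝ (Fin d)) (TangentSpace (𝓡 d)) x₀ with he
  have hbase : x₀ ∈ e.baseSet := FiberBundle.mem_baseSet_trivializationAt' x₀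
  let A : M → EuclideanSpace ℝ (Fin d) →L[ℝ] EuclideanSpace ℝ (Fin d) := fun x =>
    ((e.linearMapAt ℝ x).comp (F x).toLinearMap).toContinuousLinearMap
  have hA : ContinuousAt A x₀ := by
    rw [continuousAt_clm_apply]
    intro v
    have h1 : ContinuousAt (fun x => (⟨x, F x v⟩ : TangentBundle (𝓡 d) M)) x₀ :=
      ((hF v).continuousOn).continuousAt (hU.mem_nhds hxU)
    have h2 : ContinuousAt (fun x => (e ⟨x, F x v⟩).2) x₀ :=
      continuous_snd.continuousAt.comp (ContinuousAt.comp
        (f := fun x => (⟨x, F x v⟩ : TangentBundle (𝓡 d) M)) (e.continuousOn.continuousAt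
        (e.open_source.mem_nhds (e.mem_source.2 hbase))) h1)
    refine h2.congr ?_
    filter_upwards [e.open_baseSet.mem_nhds hbase] with x hx
    simp [A, e.coe_linearMapAt_of_mem hx]
  have hunit : IsUnit (A x₀) := by
    have : A x₀ = (((F x₀).trans (e.linearEquivAt ℝ x₀ hbase)).toContinuousLinearEquiv :
        EuclideanSpace ℝ (Fin d) →L[ℝ] EuclideanSpace ℝ (Fin d)) := by
      ext1 v
      simp [A, e.coe_linearMapAt_of_mem hbase]
    rw [this]
    exact ⟨ContinuousLinearEquiv.toUnit _, rfl⟩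
  refine ⟨A x₀ v, ?_, ?_⟩
  · intro h0
    refine hΩ.ne_zero_of_mem_interior hd hv ?_
    obtain ⟨a, ha⟩ := hunit
    have h1 : (a⁻¹.val * a.val) v = 0 := by
      rw [mul_apply_eq_comp, ha, h0, map_zero]
    simpa using h1
  · have hinv : ContinuousAt (fun x => Ring.inverse (A x)) x₀ := by
      obtain ⟨a, ha⟩ := hunit
      exact ContinuousAt.comp (g := Ring.inverse) (ha ▸ NormedRing.inverse_continuousAt a) hA
    have hcont : ContinuousAt (fun q : M × EuclideanSpace ℝ (Fin d) => Ring.inverse (A q.1) q.2)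
        (x₀, A x₀ v) :=
      (ContinuousAt.comp (f := Prod.fst) (x := (x₀, A x₀ v)) hinv continuousAt_fst).clm_apply
        continuousAt_snd
    have hval : Ring.inverse (A x₀) (A x₀ v) = v := by
      rw [← mul_apply_eq_comp, Ring.inverse_mul_cancel _ hunit]; rfl
    have hΩn : ∀ᶠ q : M × EuclideanSpace ℝ (Fin d) in 𝓝 (x₀, A x₀ v),
        Ring.inverse (A q.1) q.2 ∈ Ω := by
      refine hcont.eventually_mem ?_
      rw [hval]
      exact mem_interior_iff_mem_nhds.1 hv
    have hun : ∀ᶠ x in 𝓝 x₀, IsUnit (A x) := hA.eventually (Units.isOpen.mem_nhds hunit)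
    filter_upwards [hΩn, continuousAt_fst.eventually hun,
      continuousAt_fst.eventually (hU.mem_nhds hxU),
      continuousAt_fst.eventually (e.open_baseSet.mem_nhds hbase)] with ⟨x, w⟩ h1 h2 h3 h4 u hu
    have h4' : x ∈ (chartAt (EuclideanSpace ℝ (Fin d)) x₀).source := by
      rwa [he, TangentBundle.trivializationAt_baseSet] at h4
    rw [← hcone x h3]
    refine ⟨_, h1, ?_⟩
    have hw : A x (Ring.inverse (A x) w) = w := by
      rw [← mul_apply_eq_comp, Ring.mul_inverse_cancel _ h2]; rfl
    rw [← TangentBundle.continuousLinearMapAt_trivializationAt h4'] at hu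
    refine (e.linearEquivAt ℝ x h4).injective ?_
    have e1 : A x (Ring.inverse (A x) w) = e.linearEquivAt ℝ x h4 (F x (Ring.inverse (A x) w)) := by
      simp [A, e.coe_linearMapAt_of_mem h4]
    rw [← e1, hw]
    have e2 : e.linearEquivAt ℝ x h4 u = e.continuousLinearMapAt ℝ x u := by
      simp [e.coe_linearMapAt_of_mem h4]
    rw [e2]
    exact hu.symm

/-- In a chart, all short segments whose direction is close to a fixed vector `w` are causal. -/
lemma exists_strictCausality_chart (hd : 0 < d) (hΩ : IsClosedRegularCone Ω)
    (C : CausalStructure Ω M) (x₀ : M) :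
    ∃ w : EuclideanSpace ℝ (Fin d), w ≠ 0 ∧ ∃ ρ > 0,
      Metric.ball (extChartAt (𝓡 d) x₀ x₀) ρ ⊆ (extChartAt (𝓡 d) x₀).target ∧
      ∀ y ∈ Metric.ball (extChartAt (𝓡 d) x₀ x₀) ρ, ∀ z ∈ Metric.ball (extChartAt (𝓡 d) x₀ x₀) ρ,
        ∀ s > (0 : ℝ), s⁻¹ • (z - y) ∈ Metric.ball w ρ →
          C.StrictCausality ((extChartAt (𝓡 d) x₀).symm y) ((extChartAt (𝓡 d) x₀).symm z) := by
  have : IsManifold (𝓡 d) 1 M := IsManifold.of_le (n := ∞) (by simp)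
  obtain ⟨w, hw, hev⟩ := C.exists_eventually_mem_cone hd hΩ x₀
  set φ := extChartAt (𝓡 d) x₀ with hφ
  have hcont : ContinuousAt (fun q : EuclideanSpace ℝ (Fin d) × EuclideanSpace ℝ (Fin d) =>
      (φ.symm q.1, q.2)) (φ x₀, w) := by
    refine ContinuousAt.prodMk ?_ continuousAt_snd
    exact ContinuousAt.comp (f := Prod.fst) (x := (φ x₀, w)) (continuousAt_extChartAt_symm x₀)
      continuousAt_fst
  have hev' := hcont.eventually (by simpa [hφ] using hev)
  have htar : ∀ᶠ q : EuclideanSpace ℝ (Fin d) × EuclideanSpace ℝ (Fin d) in 𝓝 (φ x₀, w),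
      q.1 ∈ φ.target := 
    (continuousAt_fst : ContinuousAt Prod.fst (φ x₀, w)).eventually
      (extChartAt_target_mem_nhds (I := 𝓡 d) x₀)
  obtain ⟨ρ, hρ, hball⟩ := Metric.eventually_nhds_iff_ball.1 (htar.and hev')
  have hball' : ∀ y ∈ Metric.ball (φ x₀) ρ, ∀ w' ∈ Metric.ball w ρ, (y, w') ∈
      Metric.ball (φ x₀, w) ρ := fun y hy w' hw' => by
    rw [← ball_prod_same]; exact ⟨hy, hw'⟩
  have htarget : Metric.ball (φ x₀) ρ ⊆ φ.target := fun y hy =>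
    (hball _ (hball' y hy w (Metric.mem_ball_self hρ))).1
  refine ⟨w, hw, ρ, hρ, htarget, fun y hy z hz s hs hdir => ?_⟩
  -- The velocity of the segment from `y` to `z` run over the time interval `[0, s]`.
  set w' := s⁻¹ • (z - y) with hw'
  have hz' : y + s • w' = z := by
    rw [hw', smul_inv_smul₀ hs.ne']; abel
  have hline : ∀ t ∈ Icc 0 s, y + t • w' ∈ Metric.ball (φ x₀) ρ := by
    intro t ht
    refine (convex_ball (φ x₀) ρ).segment_subset hy hz ?_
    rw [segment_eq_image']
    refine ⟨t / s, ⟨div_nonneg ht.1 hs.le, (div_le_one hs).2 ht.2⟩, ?_⟩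
    simp [hw', smul_smul, div_eq_mul_inv]
  have hlin : ContMDiff 𝓘(ℝ, ℝ) 𝓘(ℝ, EuclideanSpace ℝ (Fin d)) ∞ (fun t : ℝ => y + t • w') :=
    ContDiff.contMDiff (by fun_prop)
  have hsm : ContMDiffOn 𝓘(ℝ, ℝ) (𝓡 d) ∞ (fun t : ℝ => φ.symm (y + t • w')) (Icc 0 s) :=
    (contMDiffOn_extChartAt_symm x₀).comp hlin.contMDiffOn fun t ht => htarget (hline t ht)
  refine ⟨0, s, fun t => φ.symm (y + t • w'), hs, ⟨⟨hsm.continuousOn, ∅, finite_empty,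
    hsm.mono (sdiff_subset.trans Ioo_subset_Icc_self)⟩, ∅, finite_empty, ?_⟩, by simp, by simp [hz']⟩
  rintro t ⟨ht, -⟩
  have htI := Ioo_subset_Icc_self ht
  refine (hball _ (hball' _ (hline t htI) w' hdir)).2 _ ?_
  have hd1 : MDifferentiableAt 𝓘(ℝ, ℝ) (𝓡 d) (fun t : ℝ => φ.symm (y + t • w')) t :=
    (hsm.contMDiffAt (Icc_mem_nhds ht.1 ht.2)).mdifferentiableAt (by simp)
  have hsrc : φ.symm (y + t • w') ∈ (chartAt (EuclideanSpace ℝ (Fin d)) x₀).source := by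
    rw [← extChartAt_source (𝓡 d)]
    exact φ.map_target (htarget (hline t htI))
  have hd2 : MDifferentiableAt (𝓡 d) 𝓘(ℝ, EuclideanSpace ℝ (Fin d)) φ (φ.symm (y + t • w')) :=
    mdifferentiableAt_extChartAt hsrc
  have hcomp := mfderiv_comp t (g := φ) (f := fun t : ℝ => φ.symm (y + t • w')) hd2 hd1
  have heq : (φ ∘ fun t : ℝ => φ.symm (y + t • w')) =ᶠ[𝓝 t] fun t => y + t • w' := by
    filter_upwards [Icc_mem_nhds ht.1 ht.2] with t' ht'
    exact φ.right_inv (htarget (hline t' ht'))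
  rw [heq.mfderiv_eq, mfderiv_eq_fderiv] at hcomp
  have hder : HasFDerivAt (fun t : ℝ => y + t • w')
      ((ContinuousLinearMap.id ℝ ℝ).smulRight w') t :=
    ((hasFDerivAt_id t).smul_const w').const_add y
  rw [hder.fderiv] at hcomp
  exact (DFunLike.congr_fun hcomp (1 : ℝ)).symm.trans (one_smul ℝ w')

/-- The points `x'` are `φ x ± s • w` read in the chart, for small `s > 0`. Moving either end of the
segment slightly keeps its direction near `w`; this openness is what absorbs the closure in `≼`. -/
lemma exists_strictCausality_nhds (hd : 0 < d) (hΩ : IsClosedRegularCone Ω)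
    (C : CausalStructure Ω M) (x : M) :
    (∃ x' ≠ x, (∀ᶠ y in 𝓝 x, C.StrictCausality y x') ∧ ∀ᶠ z in 𝓝 x', C.StrictCausality x z) ∧
    ∃ x', (∀ᶠ y in 𝓝 x, C.StrictCausality x' y) ∧ ∀ᶠ z in 𝓝 x', C.StrictCausality z x := by
  obtain ⟨w, hw, ρ, hρ, htar, hline⟩ := C.exists_strictCausality_chart hd hΩ x
  set φ := extChartAt (𝓡 d) x with hφ
  have key : ∀ y ∈ Metric.ball (φ x) ρ, ∀ z ∈ Metric.ball (φ x) ρ, ∀ s > (0 : ℝ),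
      s⁻¹ • (z - y) ∈ Metric.ball w ρ →
      (∀ᶠ q in 𝓝 (φ.symm y), C.StrictCausality q (φ.symm z)) ∧
        ∀ᶠ q in 𝓝 (φ.symm z), C.StrictCausality (φ.symm y) q := by
    intro y hy z hz s hs hyz
    have hc : ∀ u ∈ Metric.ball (φ x) ρ, Filter.Tendsto φ (𝓝 (φ.symm u)) (𝓝 u) ∧
        ∀ᶠ q in 𝓝 (φ.symm u), φ.symm (φ q) = q := fun u hu => by
      have hsrc : φ.symm u ∈ φ.source := φ.map_target (htar hu)
      refine ⟨?_, ?_⟩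
      · have := continuousAt_extChartAt' (I := 𝓡 d) hsrc
        rwa [ContinuousAt, ← hφ, φ.right_inv (htar hu)] at this
      · filter_upwards [(isOpen_extChartAt_source (I := 𝓡 d) x).mem_nhds hsrc] with q hq
        exact φ.left_inv hq
    constructor
    · have h1 : ∀ᶠ u in 𝓝 y, s⁻¹ • (z - u) ∈ Metric.ball w ρ :=
        (show Continuous fun u => s⁻¹ • (z - u) by fun_prop).continuousAt.eventually_mem
          (Metric.isOpen_ball.mem_nhds hyz)
      filter_upwards [(hc y hy).1.eventually h1,
        (hc y hy).1.eventually (Metric.isOpen_ball.mem_nhds hy), (hc y hy).2] with q h1 h2 h3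
      have := hline (φ q) h2 z hz s hs h1
      rwa [h3] at this
    · have h1 : ∀ᶠ u in 𝓝 z, s⁻¹ • (u - y) ∈ Metric.ball w ρ :=
        (show Continuous fun u => s⁻¹ • (u - y) by fun_prop).continuousAt.eventually_mem
          (Metric.isOpen_ball.mem_nhds hyz)
      filter_upwards [(hc z hz).1.eventually h1,
        (hc z hz).1.eventually (Metric.isOpen_ball.mem_nhds hz), (hc z hz).2] with q h1 h2 h3
      have := hline y hy (φ q) h2 s hs h1
      rwa [h3] at this
  have h0 := Metric.mem_ball_self (x := φ x) hρ
  have hsmall : ∀ᶠ s : ℝ in 𝓝 0,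
      φ x + s • w ∈ Metric.ball (φ x) ρ ∧ φ x - s • w ∈ Metric.ball (φ x) ρ := by
    refine Filter.Eventually.and ?_ ?_
    · exact (show Continuous fun s : ℝ => φ x + s • w by fun_prop).continuousAt.eventually_mem
        (Metric.isOpen_ball.mem_nhds (by simpa using hρ))
    · exact (show Continuous fun s : ℝ => φ x - s • w by fun_prop).continuousAt.eventually_mem
        (Metric.isOpen_ball.mem_nhds (by simpa using hρ))
  obtain ⟨s, ⟨hs1, hs2⟩, hs⟩ :=
    ((hsmall.filter_mono nhdsWithin_le_nhds).and (self_mem_nhdsWithin (s := Ioi (0 : ℝ)))).exists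
  have hs : 0 < s := hs
  have hx : φ.symm (φ x) = x := extChartAt_to_inv x
  obtain ⟨k1, k2⟩ := key _ h0 _ hs1 s hs (by simpa [hs.ne'] using hρ)
  obtain ⟨k3, k4⟩ := key _ hs2 _ h0 s hs (by simpa [hs.ne'] using hρ)
  rw [hx] at k1 k2 k3 k4
  refine ⟨⟨_, fun h => ?_, k1, k2⟩, _, k4, k3⟩
  have := congrArg φ h
  rw [φ.right_inv (htar hs1)] at this
  simp [hs.ne', hw] at this

end CausalStructure

namespace CausalStructure

variable {d : ℕ} {Ω : Set (EuclideanSpace ℝ (Fin d))} {M : Type*}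
  [TopologicalSpace M] [ChartedSpace (EuclideanSpace ℝ (Fin d)) M] [IsManifold (𝓡 d) ∞ M]

lemma StrictCausality.causality {C : CausalStructure Ω M} {x y : M}
    (h : C.StrictCausality x y) : C.Causality x y :=
  subset_closure h

end CausalStructure

/-! ### Deck translations of a causal covering -/

namespace IsCausalCovering

variable {d : ℕ} {Ω : Set (EuclideanSpace ℝ (Fin d))} {N M : Type*}
  [TopologicalSpace N] [ChartedSpace (EuclideanSpace ℝ (Fin d)) N] [IsManifold (𝓡 d) ∞ N]
  [TopologicalSpace M] [ChartedSpace (EuclideanSpace ℝ (Fin d)) M] [IsManifold (𝓡 d) ∞ M]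
  {CN : CausalStructure Ω N} {CM : CausalStructure Ω M}
  {T : N ≃ₘ^∞⟮𝓡 d, 𝓡 d⟯ N} {p : N → M}

/-- Choose `x'` and `y'` with a neighbourhood of `x'` above `p x` and one of `y'` below `p y`. As
`x' ≼ y'` is a limit of strict relations, some `u ≼ₛ v` has `u` and `v` in these neighbourhoods. The
chain from `p x` through `u` and `v` to `p y` lifts from `x` and ends in the fibre of `y`. -/
lemma exists_causality_zpow (hd : 0 < d) (hΩ : IsClosedRegularCone Ω)
    (hp : IsCausalCovering CN CM T p) (x y : N) :
    ∃ n : ℤ, CN.Causality x (((T.toEquiv : Equiv.Perm N) ^ n) y) := by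
  have : IsPartialOrder N CN.Causality := hp.isCausal
  have lift : ∀ {x y}, CM.StrictCausality (p x) y → ∃ z, p z = y ∧ CN.StrictCausality x z :=
    fun h => h.lift hp.isCoveringMap hp.isLocalDiffeomorph hp.map_cone
  obtain ⟨⟨x', -, -, hx'⟩, -⟩ := CM.exists_strictCausality_nhds hd hΩ (p x)
  obtain ⟨-, y', -, hy'⟩ := CM.exists_strictCausality_nhds hd hΩ (p y)
  have hev : ∀ᶠ q : M × M in 𝓝 (x', y'),
      CM.StrictCausality (p x) q.1 ∧ CM.StrictCausality q.2 (p y) :=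
    ((continuousAt_fst : ContinuousAt Prod.fst (x', y')).eventually hx').and
      ((continuousAt_snd : ContinuousAt Prod.snd (x', y')).eventually hy')
  obtain ⟨⟨u, v⟩, hq, hu, hv⟩ :=
    ((mem_closure_iff_frequently.1 (hp.isTotallyAcausal x' y')).and_eventually hev).exists
  obtain ⟨u', rfl, hu'⟩ := lift hu
  obtain ⟨v', rfl, hv'⟩ := lift hq
  obtain ⟨z, hz, hz'⟩ := lift hv
  obtain ⟨n, rfl⟩ := (hp.fiber_eq_orbit y z).1 hz.symm
  exact ⟨n, trans_of CN.Causality hu'.causality (trans_of CN.Causality hv'.causality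
    hz'.causality)⟩

lemma exists_isCompact [CompactSpace M] (hp : IsCausalCovering CN CM T p) :
    ∃ K : Set N, IsCompact K ∧ ∀ z, ∃ n : ℤ, ∃ k ∈ K, z = ((T.toEquiv : Equiv.Perm N) ^ n) k := by
  have : LocallyCompactSpace N := ChartedSpace.locallyCompactSpace (EuclideanSpace ℝ (Fin d)) N
  obtain ⟨K, hK, hKM⟩ : ∃ K : Set N, IsCompact K ∧ univ ⊆ p '' K := by
    refine isCompact_univ.induction_on ⟨∅, isCompact_empty, empty_subset _⟩ ?_ ?_ ?_
    · rintro s t hst ⟨K, hK, h⟩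
      exact ⟨K, hK, hst.trans h⟩
    · rintro s t ⟨K, hK, h⟩ ⟨K', hK', h'⟩
      exact ⟨K ∪ K', hK.union hK', by rw [image_union]; exact union_subset_union h h'⟩
    · intro m _
      obtain ⟨x, rfl⟩ := hp.surjective m
      obtain ⟨K, hK, hKx⟩ := exists_compact_mem_nhds x
      exact ⟨p '' K, mem_nhdsWithin_of_mem_nhds
        (hp.isLocalDiffeomorph.isOpenMap.image_mem_nhds hKx), K, hK, subset_rfl⟩
  refine ⟨K, hK, fun z => ?_⟩
  obtain ⟨k, hk, hkz⟩ := hKM (mem_univ (p z))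
  obtain ⟨n, hn⟩ := (hp.fiber_eq_orbit k z).1 hkz
  exact ⟨n, k, hk, hn.symm⟩

omit [IsManifold (𝓡 d) ∞ N] in
lemma continuous_zpow (T : N ≃ₘ^∞⟮𝓡 d, 𝓡 d⟯ N) (n : ℤ) :
    Continuous ((T.toEquiv : Equiv.Perm N) ^ n : Equiv.Perm N) := by
  induction n using Int.induction_on with
  | zero => exact continuous_id
  | succ n ih =>
    rw [zpow_add_one, Equiv.Perm.coe_mul]
    exact ih.comp T.continuous
  | pred n ih =>
    rw [zpow_sub_one, Equiv.Perm.coe_mul]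
    exact ih.comp T.symm.continuous

/-- One of the two generators of the deck group of a causal covering moves some point strictly
upwards. -/
lemma exists_isCocompactDominated [CompactSpace M] (hd : 0 < d) (hΩ : IsClosedRegularCone Ω)
    (hp : IsCausalCovering CN CM T p) :
    IsCocompactDominated CN.Causality (T.toEquiv : Equiv.Perm N) ∨
      IsCocompactDominated CN.Causality (T.toEquiv : Equiv.Perm N)⁻¹ := by
  have hpo : IsPartialOrder N CN.Causality := hp.isCausal
  have hT : ∀ a b, CN.Causality (T.toEquiv a) (T.toEquiv b) ↔ CN.Causality a b :=
    hp.isCausalDiffeo.causality_iff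
  have hfin : ∀ a b, {n : ℤ | ((T.toEquiv : Equiv.Perm N) ^ n) a = b}.Finite := fun a b => by
    simpa [eq_comm] using hp.properlyDiscontinuous {a} {b} isCompact_singleton isCompact_singleton
  have hle : ∀ x, ∃ y, ∀ᶠ z in 𝓝 x, CN.Causality z y := fun x => by
    obtain ⟨⟨y, -, hy, -⟩, -⟩ := CN.exists_strictCausality_nhds hd hΩ x
    exact ⟨y, hy.mono fun z hz => hz.causality⟩
  have hge : ∀ x, ∃ y, ∀ᶠ z in 𝓝 x, CN.Causality y z := fun x => by
    obtain ⟨-, y, hy, -⟩ := CN.exists_strictCausality_nhds hd hΩ x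
    exact ⟨y, hy.mono fun z hz => hz.causality⟩
  -- On an empty `N` every permutation is trivial, so `T` could not have infinite order.
  obtain ⟨x⟩ : Nonempty N := by
    by_contra hN
    have := not_nonempty_iff.1 hN
    exact hp.infinite_order 1 one_ne_zero (Subsingleton.elim _ _)
  obtain ⟨⟨y, hyx, hy, -⟩, -⟩ := CN.exists_strictCausality_nhds hd hΩ x
  have hxy : CN.Causality x y := hy.self_of_nhds.causality
  obtain ⟨n, hn⟩ := hp.exists_causality_zpow hd hΩ y x
  have hne : ((T.toEquiv : Equiv.Perm N) ^ n) x ≠ x := fun h => by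
    rw [h] at hn
    exact hyx (antisymm_of CN.Causality hn hxy)
  have hxn := trans_of CN.Causality hxy hn
  -- Since `x ≺ T ^ n x`, the generator moving `x` upwards is `T` for `n = m` and `T⁻¹` for `n =
  -- -m`; all other conditions are symmetric under `n ↦ -n`.
  obtain ⟨m, rfl | rfl⟩ := n.eq_nat_or_neg
  · left
    exact ⟨hpo, isClosed_closure, hT, continuous_zpow T, hle, hge, hp.exists_causality_zpow hd hΩ,
      hfin, hp.exists_isCompact, x, m, hxn, hne⟩
  · right
    refine ⟨hpo, isClosed_closure, fun a b => ?_, fun n => ?_, hle, hge, fun x y => ?_,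
      fun a b => ?_, ?_, x, m, by rwa [inv_zpow'], by rwa [inv_zpow']⟩
    · rw [← hT]
      simp
    · rw [inv_zpow']
      exact continuous_zpow T (-n)
    · obtain ⟨n, hn⟩ := hp.exists_causality_zpow hd hΩ x y
      exact ⟨-n, by rwa [inv_zpow', neg_neg]⟩
    · simp_rw [inv_zpow']
      exact (hfin a b).preimage neg_injective.injOn
    · obtain ⟨K, hK, hKN⟩ := hp.exists_isCompact
      refine ⟨K, hK, fun z => ?_⟩
      obtain ⟨n, k, hk, hz⟩ := hKN z
      exact ⟨-n, k, hk, by rwa [inv_zpow', neg_neg]⟩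

end IsCausalCovering

theorem theorem5p9 {d : ℕ} (hd : 0 < d) {Ω : Set (EuclideanSpace ℝ (Fin d))}
    (hΩ : IsClosedRegularCone Ω) {N M : Type*}
    [TopologicalSpace N] [T2Space N]
    [ChartedSpace (EuclideanSpace ℝ (Fin d)) N] [IsManifold (𝓡 d) ∞ N]
    [TopologicalSpace M] [T2Space M] [CompactSpace M]
    [ChartedSpace (EuclideanSpace ℝ (Fin d)) M] [IsManifold (𝓡 d) ∞ M]
    (CN : CausalStructure Ω N) (CM : CausalStructure Ω M)
    (T : N ≃ₘ^∞⟮𝓡 d, 𝓡 d⟯ N) (p : N → M) (hp : IsCausalCovering CN CM T p) :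
    IsGloballyHyperbolic CN.Causality ∧
      ∃ S : Equiv.Perm N,
        ((S = T.toEquiv ∨ S = T.toEquiv.symm) ∧ IsDominant CN.Causality S ∧
          ∀ S' : Equiv.Perm N, (S' = T.toEquiv ∨ S' = T.toEquiv.symm) →
            IsDominant CN.Causality S' → S' = S) ∧
        IsGloballyHyperbolic (Completion CN.Causality S) := by
  rcases hp.exists_isCocompactDominated hd hΩ with h | h
  · refine ⟨h.isGloballyHyperbolic, T.toEquiv, ⟨Or.inl rfl, h.isDominant, ?_⟩,
      h.isGloballyHyperbolic_completion⟩
    rintro S' (rfl | rfl) hS'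
    · rfl
    · exact absurd hS' h.not_isDominant_inv
  · refine ⟨h.isGloballyHyperbolic, T.toEquiv.symm, ⟨Or.inr rfl, h.isDominant, ?_⟩,
      h.isGloballyHyperbolic_completion⟩
    rintro S' (rfl | rfl) hS'
    · exact absurd hS' h.not_isDominant_inv
    · rfl
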